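/- Let $M$ be a compact (Hausdorff) $n$-dimensional smooth manifold with corners, with interior $M_0 = M\setminus\partial M$. Let $\mathcal V$ be a set of smooth vector fields on $M$ such that: (i) $\mathcal V$ is a $C^\infty(M)$-submodule of $\Gamma(TM)$, closed under Lie brackets and finitely generated and projective as a $C^\infty(M)$-module; (ii) every vector field in $\mathcal V$ is tangent to all faces of $M$. Let $A=A_{\mathcal V}\to M$ be the vector bundle with $\Gamma(A)=\mathcal V$, whose fiber at $x$ is $A_x=\mathcal V/\mathfrak p_x\mathcal V$, where $\mathfrak p_x\subset C^\infty(M)$ is the ideal of functions vanishing at $x$, and let $\varrho:A\to TM$ be the bundle map sending the class of $X\in\mathcal V$ in $A_x$ to $X(x)$. Assume that (iii) $\varrho_x:A_x\to T_xM$ is an isomorphism for every $x\in M_0$. (Thus $(M,\mathcal V)$ is a Lie structure at infinity on $M_0$.) Let $g$ be a Riemannian metric on $A$, that is, a smooth positive definite symmetric $2$-tensor on $A$; through the isomorphism $\varrho|_{M_0}:A|_{M_0}\to TM_0$ it induces a Riemannian metric on $M_0$, also denoted by $g$. Then $M_0$ is complete in the induced metric $g$: every Cauchy sequence in $M_0$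 for the Riemannian distance of $g$ (the infimum of the $g$-lengths of $C^1$ paths in $M_0$, equal to $\infty$ between different components) converges in $M_0$. -/

import Mathlib

open scoped Manifold ContDiff Topology ENNReal

noncomputable section

namespace LieInfinity

/-- The model with corners `[0,∞)ⁿ ⊆ ℝⁿ`. An `n`-dimensional smooth manifold with corners is a
space charted on `[0,∞)ⁿ` with smooth transition maps: the local models `[0,∞)ᵏ × ℝⁿ⁻ᵏ` are
diffeomorphic to relatively open subsets of `[0,∞)ⁿ`. -/
abbrev corners (n : ℕ) :
    ModelWithCorners ℝ (EuclideanSpace ℝ (Fin n)) (EuclideanQuadrant n) :=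
  modelWithCornersEuclideanQuadrant n

section Functions

variable (n : ℕ) (M : Type*) [TopologicalSpace M] [ChartedSpace (EuclideanQuadrant n) M]

/-- The ring `C^∞(M)` of smooth real functions on `M` (smooth up to the boundary). -/
abbrev SmoothFun : Type _ := C^∞⟮corners n, M; ℝ⟯

variable [IsManifold (corners n) ∞ M]

/-- The space `Γ(TM)` of smooth vector fields on `M` (smooth up to the boundary). -/
abbrev VecField : Type _ :=
  Cₛ^∞⟮corners n; EuclideanSpace ℝ (Fin n), (TangentSpace (corners n) : M → Type _)⟯

end Functions

variable {n : ℕ} {M : Type*} [TopologicalSpace M] [ChartedSpace (EuclideanQuadrant n) M]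
  [IsManifold (corners n) ∞ M]

/-- Pointwise multiplication of a vector field by a function. -/
instance : SMul (SmoothFun n M) (VecField n M) where
  smul f X := ⟨fun x => f x • X x, f.contMDiff.smul_section X.contMDiff⟩

@[simp] theorem smul_apply (f : SmoothFun n M) (X : VecField n M) (x : M) :
    (f • X) x = f x • X x := rfl

/-- `Γ(TM)` as a module over `C^∞(M)`. -/
instance : Module (SmoothFun n M) (VecField n M) where
  one_smul X := by ext1 x; exact one_smul ℝ (X x)
  mul_smul f g X := by ext1 x; exact mul_smul (f x) (g x) (X x)
  smul_zero f := by ext1 x; exact smul_zero (f x)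
  smul_add f X Y := by ext1 x; exact smul_add (f x) (X x) (Y x)
  add_smul f g X := by ext1 x; exact add_smul (f x) (g x) (X x)
  zero_smul X := by ext1 x; exact zero_smul ℝ (X x)

instance : IsScalarTower ℝ (SmoothFun n M) (VecField n M) where
  smul_assoc c f X := by ext1 x; exact smul_assoc c (f x) (X x)

/-- Evaluation of a vector field at a point. -/
def evalAt (x : M) : VecField n M →ₗ[ℝ] TangentSpace (corners n) x where
  toFun X := X x
  map_add' _ _ := rfl
  map_smul' _ _ := rfl

/-- `X` is tangent to all faces of `M`: for every coordinate function `xᵢ` of a chart with values in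
`[0,∞)ⁿ`, the derivative `dxᵢ(X)` vanishes at the points where `xᵢ = 0`, that is, on the (local)
boundary hyperface defined by `xᵢ`. -/
def TangentToFaces (X : VecField n M) : Prop :=
  ∀ x y : M, y ∈ (extChartAt (corners n) x).source → ∀ i : Fin n,
    extChartAt (corners n) x y i = 0 →
    mfderiv (corners n) 𝓘(ℝ, ℝ) (fun z : M => extChartAt (corners n) x z i) y (X y) = 0

/-- A structural Lie algebra of vector fields on `M`: a `C^∞(M)`-submodule of `Γ(TM)`, closed under
Lie brackets, finitely generated and projective as a `C^∞(M)`-module, and consisting of vector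
fields tangent to all faces of `M`. -/
structure IsStructuralLieAlgebra (V : Submodule (SmoothFun n M) (VecField n M)) : Prop where
  bracket_mem : ∀ X ∈ V, ∀ Y ∈ V, ∃ Z ∈ V, ∀ x : M,
    Z x = VectorField.mlieBracket (corners n) (fun y => X y) (fun y => Y y) x
  finite : Module.Finite (SmoothFun n M) V
  projective : Module.Projective (SmoothFun n M) V
  tangent : ∀ X ∈ V, TangentToFaces X

variable (n) in
/-- The ideal `𝔭ₓ` of smooth functions that vanish at `x`. -/
def vanishingIdeal (x : M) : Ideal (SmoothFun n M) :=
  RingHom.ker (ContMDiffMap.evalRingHom x : SmoothFun n M →+* ℝ)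

/-- The subspace `𝔭ₓ V` of `V`. -/
def vanishingSubspace (V : Submodule (SmoothFun n M) (VecField n M)) (x : M) : Submodule ℝ V :=
  (vanishingIdeal n x • (⊤ : Submodule (SmoothFun n M) V)).restrictScalars ℝ

/-- The geometric fiber `Aₓ = V / 𝔭ₓ V` at `x` of the vector bundle `A = A_V` with `Γ(A) = V`. -/
abbrev Fiber (V : Submodule (SmoothFun n M) (VecField n M)) (x : M) : Type _ :=
  V ⧸ vanishingSubspace V x

/-- The value at `x` of an element of `V`, regarded as a section of `A`. -/
def fiberMk (V : Submodule (SmoothFun n M) (VecField n M)) (x : M) : V →ₗ[ℝ] Fiber V x :=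
  (vanishingSubspace V x).mkQ

/-- Evaluation at `x` of vector fields in `V`. -/
def evalOn (V : Submodule (SmoothFun n M) (VecField n M)) (x : M) :
    V →ₗ[ℝ] TangentSpace (corners n) x :=
  evalAt x ∘ₗ (V.subtype.restrictScalars ℝ)

theorem vanishingSubspace_le_ker (V : Submodule (SmoothFun n M) (VecField n M)) (x : M) :
    vanishingSubspace V x ≤ LinearMap.ker (evalOn V x) := by
  intro X hX
  have hX' : X ∈ vanishingIdeal n x • (⊤ : Submodule (SmoothFun n M) V) := hX
  refine Submodule.smul_induction_on hX' ?_ ?_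
  · intro f hf Y _
    have hf' : f x = 0 := hf
    change f x • (Y : VecField n M) x = 0
    rw [hf', zero_smul]
  · intro Y Z hY hZ
    exact Submodule.add_mem _ hY hZ

/-- The anchor `ϱₓ : Aₓ → TₓM`, sending the class of `X ∈ V` to the vector `X x`. -/
def anchor (V : Submodule (SmoothFun n M) (VecField n M)) (x : M) :
    Fiber V x →ₗ[ℝ] TangentSpace (corners n) x :=
  (vanishingSubspace V x).liftQ (evalOn V x) (vanishingSubspace_le_ker V x)

variable (n M) in
/-- The interior `M₀ = M ∖ ∂M`, an open subset of `M` and hence itself a smooth manifold. -/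
def interiorOpens : TopologicalSpace.Opens M :=
  ⟨(corners n).interior M, (corners n).isOpen_interior (n := ∞) (by simp)⟩

variable (n M) in
/-- A Lie structure at infinity on the interior `M₀` of `M`: a structural Lie algebra `V` of vector
fields on `M` whose anchor `A_V → TM` is a fiberwise isomorphism over `M₀`. (Compactness of `M` is
a separate assumption.) -/
structure LieStructure where
  V : Submodule (SmoothFun n M) (VecField n M)
  structural : IsStructuralLieAlgebra V
  anchor_bijective : ∀ x ∈ interiorOpens n M, Function.Bijective (anchor V x)

namespace LieStructure

/-- A Riemannian metric on `A = A_V`: a positive definite symmetric bilinear form on each fiber,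
depending smoothly on the point, i.e. such that `g(X, Y)` is a smooth function on `M` for all
smooth sections `X, Y ∈ V = Γ(A)` of `A`. -/
structure Metric (L : LieStructure n M) where
  form : ∀ x : M, Fiber L.V x →ₗ[ℝ] Fiber L.V x →ₗ[ℝ] ℝ
  symm : ∀ (x : M) (v w : Fiber L.V x), form x v w = form x w v
  pos : ∀ (x : M) (v : Fiber L.V x), v ≠ 0 → 0 < form x v v
  smooth : ∀ X Y : L.V, ContMDiff (corners n) 𝓘(ℝ, ℝ) ∞
    (fun x => form x (fiberMk L.V x X) (fiberMk L.V x Y))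

/-- The anchor as a linear isomorphism `Aₓ ≃ TₓM` at interior points. -/
def anchorEquiv (L : LieStructure n M) (x : interiorOpens n M) :
    Fiber L.V (x : M) ≃ₗ[ℝ] TangentSpace (corners n) (x : M) :=
  LinearEquiv.ofBijective (anchor L.V (x : M)) (L.anchor_bijective x x.2)

/-- The map `TₓM₀ → TₓM → Aₓ`: differential of the inclusion, then the inverse of the anchor. -/
def toFiber (L : LieStructure n M) (x : interiorOpens n M) :
    TangentSpace (corners n) x →ₗ[ℝ] Fiber L.V (x : M) :=
  (L.anchorEquiv x).symm.toLinearMap ∘ₗ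
    (mfderiv (corners n) (corners n) (Subtype.val : interiorOpens n M → M) x).toLinearMap

namespace Metric

variable {L : LieStructure n M}

/-- The Riemannian metric on `M₀` induced by a metric on `A`. -/
def induced (g : L.Metric) (x : interiorOpens n M) :
    TangentSpace (corners n) x →ₗ[ℝ] TangentSpace (corners n) x →ₗ[ℝ] ℝ :=
  (g.form (x : M)).compl₁₂ (L.toFiber x) (L.toFiber x)

/-- The Riemannian distance on `M₀`: the infimum of the `g`-lengths `∫ √g(γ', γ')` of the `C¹` paths
in `M₀` between two points (infinite if there are none). -/
def dist (g : L.Metric) (x y : interiorOpens n M) : ℝ≥0∞ :=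
  letI : ∀ z : interiorOpens n M, ENorm (TangentSpace (corners n) z) :=
    fun z => ⟨fun v => ENNReal.ofReal (Real.sqrt (g.induced z v v))⟩
  Manifold.riemannianEDist (corners n) x y

/-- `M₀` is complete in the induced metric: every Cauchy sequence for the Riemannian distance
converges, for this distance, to a point of `M₀`. -/
def IsComplete (g : L.Metric) : Prop :=
  ∀ u : ℕ → interiorOpens n M,
    (∀ ε : ℝ≥0∞, 0 < ε → ∃ N : ℕ, ∀ j ≥ N, ∀ k ≥ N, g.dist (u j) (u k) < ε) →
    ∃ x : interiorOpens n M, Filter.Tendsto (fun k => g.dist (u k) x) Filter.atTop (𝓝 0)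

end Metric

end LieStructure

end LieInfinity

end

/-!
The proof rests on a uniform comparison of three quantities. Since `V` is finitely generated and
projective, `A_V` is a subbundle of a trivial bundle `M × ℝᵐ`, the image of a smooth family of
projections (`ProjectiveFrame`); a continuous fiberwise quadratic function that is positive on
`A_V ∖ 0` over a compact set therefore dominates a multiple of the Euclidean norm of the
coordinates there (`ProjectiveFrame.exists_pos_mul_sq_le`).

Applied to the metric over the compact space `M`, this bounds the differential of a smooth function
on `M` by its derivatives along the generators of `V`, uniformly up to the boundary
(`exists_mfderiv_le`). In particular every smooth function on `M` is Lipschitz for the Riemannian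
distance. If `x` is a coordinate of a chart at a boundary point `p` with `x(p) = 0`, tangency to the
faces and Hadamard's lemma give `|X x| ≤ C x` near `p` for the generators `X`, so `log x` is
Lipschitz along paths that stay near `p`. A short path starting close enough to `p` does stay near
`p`, because a bump function at `p` is Lipschitz; but `log x → -∞` at `p`, so the boundary point `p`
is not an accumulation point of a Cauchy sequence (`mem_interior_of_mapClusterPt`).

By compactness a Cauchy sequence does accumulate at some point of `M`, hence at a point of `M₀`. Over
a compact part of a chart in `M₀` the anchor is injective, so the same comparison bounds the metric
from above by the Euclidean metric of the chart; thus the Riemannian distance is continuous at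
interior points (`eventually_dist_lt`) and the sequence converges.
-/

noncomputable section

namespace LieInfinity

variable {n : ℕ} {M : Type*} [TopologicalSpace M] [ChartedSpace (EuclideanQuadrant n) M]

/-! ### Charts of manifolds with corners -/

section Charts

theorem range_corners :
    Set.range (corners n) = {z : EuclideanSpace ℝ (Fin n) | ∀ i, 0 ≤ z i} :=
  range_euclideanQuadrant n

theorem extChartAt_nonneg {p y : M} (hy : y ∈ (extChartAt (corners n) p).source) (i : Fin n) :
    0 ≤ extChartAt (corners n) p y i := by
  have h := extChartAt_target_subset_range p ((extChartAt (corners n) p).map_source hy)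
  rw [range_corners] at h
  exact h i

/-- A property that holds near `p` holds on a convex neighbourhood in the chart: the part of a ball
that lies in the quadrant `[0,∞)ⁿ`. -/
theorem exists_ball_subset_of_eventually {p : M} {P : M → Prop} (h : ∀ᶠ y in 𝓝 p, P y) :
    ∃ r > 0, ∀ z ∈ Metric.ball (extChartAt (corners n) p p) r, (∀ i, 0 ≤ z i) →
      z ∈ (extChartAt (corners n) p).target ∧ P ((extChartAt (corners n) p).symm z) := by
  have h1 : ∀ᶠ z in 𝓝[Set.range (corners n)] (extChartAt (corners n) p p),
      P ((extChartAt (corners n) p).symm z) := by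
    rw [← map_extChartAt_nhds, Filter.eventually_map]
    filter_upwards [h, extChartAt_source_mem_nhds (I := corners n) p] with y hy hys
    rwa [(extChartAt (corners n) p).left_inv hys]
  obtain ⟨r, hr, hrs⟩ := Metric.mem_nhdsWithin_iff.1
    (Filter.inter_mem (extChartAt_target_mem_nhdsWithin (I := corners n) p) h1)
  refine ⟨r, hr, fun z hz hz0 => hrs ⟨hz, ?_⟩⟩
  rw [range_corners]
  exact hz0

/-- A version of Hadamard's lemma: a smooth function that vanishes on the hyperface `{xᵢ = 0}`
through `p` is bounded near `p` by a multiple of `xᵢ`. In a convex chart it is Lipschitz, and it is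
compared with its value at the orthogonal projection onto the hyperface. -/
theorem exists_abs_le_mul_coordinate {p : M} {i : Fin n}
    (hi : extChartAt (corners n) p p i = 0) (h : SmoothFun n M)
    (h0 : ∀ᶠ y in 𝓝 p, extChartAt (corners n) p y i = 0 → h y = 0) :
    ∃ C ≥ 0, ∀ᶠ y in 𝓝 p, |h y| ≤ C * extChartAt (corners n) p y i := by
  set e := extChartAt (corners n) p with he
  have h1 : ContDiffWithinAt ℝ 1 (h ∘ e.symm) (Set.range (corners n)) (e p) := by
    have := (contMDiffAt_iff.1 (h.contMDiff p)).2
    exact this.of_le (by simp)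
  obtain ⟨K, t, ht, hK⟩ := h1.exists_lipschitzOnWith (corners n).convex_range
  obtain ⟨r, hr, hrt⟩ := exists_ball_subset_of_eventually (n := n) h0
  obtain ⟨r', hr', hrt'⟩ := Metric.mem_nhdsWithin_iff.1 ht
  refine ⟨K, K.2, ?_⟩
  filter_upwards [extChartAt_source_mem_nhds (I := corners n) p,
    (continuousAt_extChartAt (I := corners n) p).preimage_mem_nhds
      (Metric.ball_mem_nhds _ (lt_min hr hr'))] with y hys hyb
  have hz0 (j : Fin n) : 0 ≤ e y j := extChartAt_nonneg (n := n) hys j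
  let z' : EuclideanSpace ℝ (Fin n) := WithLp.toLp 2 (Function.update (e y) i 0)
  have hz' (j : Fin n) : z' j = if j = i then 0 else e y j := by
    simp [z', Function.update_apply]
  have hz'0 (j : Fin n) : 0 ≤ z' j := by
    rw [hz']
    split_ifs
    exacts [le_rfl, hz0 j]
  have hyb' : Metric.ball (e p) (min r r') (e y) := hyb
  have hz'b : z' ∈ Metric.ball (e p) (min r r') := by
    refine lt_of_le_of_lt ?_ (show dist (e y) (e p) < min r r' from hyb)
    rw [EuclideanSpace.dist_eq, EuclideanSpace.dist_eq]
    refine Real.sqrt_le_sqrt (Finset.sum_le_sum fun j _ => ?_)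
    rw [hz']
    split_ifs with hj
    · rw [hj, hi, dist_self]
      exact (zero_pow two_ne_zero).trans_le (sq_nonneg _)
    · exact le_rfl
  have hd : dist (e y) z' = e y i := by
    rw [EuclideanSpace.dist_eq, Finset.sum_eq_single i]
    · rw [hz', if_pos rfl, Real.sqrt_sq dist_nonneg, Real.dist_eq, sub_zero, abs_of_nonneg (hz0 i)]
    · intro j _ hj
      rw [hz', if_neg hj, dist_self]
      simp
    · simp
  obtain ⟨hz't, hz'h⟩ := hrt z' (Metric.ball_subset_ball (min_le_left _ _) hz'b) hz'0
  have hv : h (e.symm z') = 0 := by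
    refine hz'h ?_
    rw [← he, e.right_inv hz't, hz', if_pos rfl]
  have hl := hK.dist_le_mul (e y)
    (hrt' ⟨Metric.ball_subset_ball (min_le_right _ _) hyb, by rw [range_corners]; exact hz0⟩) z'
    (hrt' ⟨Metric.ball_subset_ball (min_le_right _ _) hz'b, by rw [range_corners]; exact hz'0⟩)
  rw [hd] at hl
  simp only [Function.comp_apply, e.left_inv hys, hv, Real.dist_eq, sub_zero] at hl
  exact hl

end Charts

variable [IsManifold (corners n) ∞ M]

/-! ### The bundle `A_V` as a subbundle of a trivial bundle -/

/-- The derivative `X f` of a smooth function `f` along a vector field `X`. -/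
def derivAlong (X : VecField n M) (f : SmoothFun n M) : SmoothFun n M where
  val y := mfderiv (corners n) 𝓘(ℝ, ℝ) f y (X y)
  property := by
    have h1 : ContMDiff (corners n) 𝓘(ℝ, ℝ).tangent ∞
        (fun y => tangentMap (corners n) 𝓘(ℝ, ℝ) f ⟨y, X y⟩) :=
      (f.contMDiff.contMDiff_tangentMap (m := ∞) (by simp)).comp X.contMDiff
    exact (contMDiff_snd_tangentBundle_modelSpace ℝ 𝓘(ℝ, ℝ)).comp h1

theorem derivAlong_apply (X : VecField n M) (f : SmoothFun n M) (y : M) :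
    derivAlong X f y = mfderiv (corners n) 𝓘(ℝ, ℝ) f y (X y) := rfl

section Frame

variable (V : Submodule (SmoothFun n M) (VecField n M))

/-- Generators `gen a` of `V` together with a `C^∞(M)`-linear section `coord` of the corresponding
surjection `C^∞(M)ᵐ → V`. It identifies `V` with a direct summand of `C^∞(M)ᵐ`, and the bundle `A_V`
with a subbundle of the trivial bundle `M × ℝᵐ`. -/
structure ProjectiveFrame (m : ℕ) where
  gen : Fin m → V
  coord : V →ₗ[SmoothFun n M] (Fin m → SmoothFun n M)
  sum_coord : ∀ Y : V, ∑ a, coord Y a • gen a = Y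

variable {V}

theorem exists_projectiveFrame [Module.Finite (SmoothFun n M) V]
    [Module.Projective (SmoothFun n M) V] : ∃ m, Nonempty (ProjectiveFrame V m) := by
  obtain ⟨m, f, hf⟩ := Module.Finite.exists_fin' (SmoothFun n M) V
  obtain ⟨s, hs⟩ := Module.projective_lifting_property f LinearMap.id hf
  refine ⟨m, ⟨⟨fun a => f (Pi.single a 1), s, fun Y => ?_⟩⟩⟩
  conv_rhs => rw [show Y = f (s Y) from (LinearMap.congr_fun hs Y).symm,
    pi_eq_sum_univ' (s Y), map_sum]
  refine Finset.sum_congr rfl fun a _ => ?_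
  rw [map_smul]

theorem fiberMk_smul (f : SmoothFun n M) (Y : V) (y : M) :
    fiberMk V y (f • Y) = f y • fiberMk V y Y := by
  rw [← map_smul, ← sub_eq_zero, ← map_sub]
  refine (Submodule.Quotient.mk_eq_zero _).2 ?_
  have h : f • Y - f y • Y = (f - ContMDiffMap.const (f y) : SmoothFun n M) • Y := by
    apply Subtype.ext
    ext1 x
    exact (sub_smul (f x) (f y) ((Y : VecField n M) x)).symm
  change _ ∈ vanishingIdeal n y • (⊤ : Submodule (SmoothFun n M) V)
  rw [h]
  refine Submodule.smul_mem_smul ?_ Submodule.mem_top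
  change f y - f y = 0
  exact sub_self _

namespace ProjectiveFrame

variable {m : ℕ} (F : ProjectiveFrame V m)

/-- The linear combination of the generators with constant coefficients `w`. -/
def combination : (Fin m → ℝ) →ₗ[ℝ] V where
  toFun w := ∑ a, w a • F.gen a
  map_add' v w := by simp [add_smul, Finset.sum_add_distrib]
  map_smul' c v := by simp [Finset.smul_sum, smul_smul]

/-- The coordinates in `ℝᵐ` of the value of `Y` at `y` as a section of `A_V`. -/
def coordAt (y : M) : V →ₗ[ℝ] (Fin m → ℝ) where
  toFun Y a := F.coord Y a y
  map_add' Y Z := by ext a; simp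
  map_smul' c Y := by
    ext a
    rw [← algebraMap_smul (SmoothFun n M) c Y, map_smul]
    rfl

theorem coordAt_smul (f : SmoothFun n M) (Y : V) (y : M) :
    F.coordAt y (f • Y) = f y • F.coordAt y Y := by
  ext a
  simp [coordAt]

theorem coordAt_eq_zero_of_fiberMk {y : M} {Y : V} (h : fiberMk V y Y = 0) :
    F.coordAt y Y = 0 := by
  have h' : Y ∈ vanishingIdeal n y • (⊤ : Submodule (SmoothFun n M) V) :=
    (Submodule.Quotient.mk_eq_zero (vanishingSubspace V y)).1 h
  refine Submodule.smul_induction_on h' ?_ ?_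
  · intro f hf Z _
    have hf' : f y = 0 := hf
    rw [coordAt_smul, hf', zero_smul]
  · intro Y Z hY hZ
    rw [map_add, hY, hZ, add_zero]

/-- The fiber coordinates determine the class in the fiber; with `coordAt_eq_zero_of_fiberMk`, this
identifies the fiber of `A_V` at `y` with a subspace of `ℝᵐ`. -/
theorem fiberMk_combination_coordAt (y : M) (Y : V) :
    fiberMk V y (F.combination (F.coordAt y Y)) = fiberMk V y Y := by
  conv_rhs => rw [← F.sum_coord Y, map_sum]
  simp only [combination, LinearMap.coe_mk, AddHom.coe_mk, map_sum, map_smul, fiberMk_smul]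
  rfl

/-- The image of `A_V` in the trivial bundle `M × ℝᵐ`, as the set of fixed vectors of the smooth
family of projections `w ↦ coordAt y (combination w)`. -/
def total : Set (M × (Fin m → ℝ)) := {q | F.coordAt q.1 (F.combination q.2) = q.2}

theorem isClosed_total : IsClosed F.total := by
  refine isClosed_eq ?_ continuous_snd
  refine continuous_pi fun a => ?_
  have : (fun q : M × (Fin m → ℝ) => F.coordAt q.1 (F.combination q.2) a) =
      fun q => ∑ b, q.2 b * F.coord (F.gen b) a q.1 := by
    ext q
    simp only [combination, LinearMap.coe_mk, AddHom.coe_mk, map_sum, map_smul]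
    simp [coordAt]
  rw [this]
  have (b : Fin m) : Continuous fun y => F.coord (F.gen b) a y :=
    (F.coord (F.gen b) a).contMDiff.continuous
  fun_prop

theorem mem_total (y : M) (Y : V) : (y, F.coordAt y Y) ∈ F.total := by
  change F.coordAt y (F.combination (F.coordAt y Y)) = F.coordAt y Y
  rw [← sub_eq_zero, ← map_sub]
  apply F.coordAt_eq_zero_of_fiberMk
  rw [map_sub, F.fiberMk_combination_coordAt, sub_self]

theorem fiberMk_combination_ne_zero {y : M} {w : Fin m → ℝ} (h : (y, w) ∈ F.total) (hw : w ≠ 0) :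
    fiberMk V y (F.combination w) ≠ 0 := by
  intro h0
  have h1 : F.coordAt y (F.combination w) = w := h
  exact hw (h1 ▸ F.coordAt_eq_zero_of_fiberMk h0)

/-- A continuous function on `M × ℝᵐ` that is quadratic in the fiber and positive on the nonzero
vectors of `A_V` over a compact set is bounded below there by a positive multiple of `‖w‖²`:
restrict it to the unit sphere bundle, which is compact. -/
theorem exists_pos_mul_sq_le {K : Set M} (hK : IsCompact K) {q : M × (Fin m → ℝ) → ℝ}
    (hq : Continuous q) (hsmul : ∀ y w (c : ℝ), q (y, c • w) = c ^ 2 * q (y, w))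
    (hpos : ∀ y ∈ K, ∀ w, (y, w) ∈ F.total → w ≠ 0 → 0 < q (y, w)) :
    ∃ c > 0, ∀ y ∈ K, ∀ w, (y, w) ∈ F.total → c * ‖w‖ ^ 2 ≤ q (y, w) := by
  have hS : IsCompact ((K ×ˢ Metric.sphere (0 : Fin m → ℝ) 1) ∩ F.total) :=
    (hK.prod (isCompact_sphere _ _)).inter_right F.isClosed_total
  obtain ⟨c, hc, hcq⟩ : ∃ c > 0,
      ∀ x ∈ (K ×ˢ Metric.sphere (0 : Fin m → ℝ) 1) ∩ F.total, c ≤ q x := by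
    rcases Set.eq_empty_or_nonempty ((K ×ˢ Metric.sphere (0 : Fin m → ℝ) 1) ∩ F.total) with h | h
    · exact ⟨1, one_pos, by simp [h]⟩
    · obtain ⟨x, hx, hmin⟩ := hS.exists_isMinOn h hq.continuousOn
      refine ⟨q x, ?_, fun z hz => hmin hz⟩
      refine hpos x.1 hx.1.1 x.2 hx.2 ?_
      rintro h0
      have := hx.1.2
      simp [h0] at this
  refine ⟨c, hc, fun y hy w hw => ?_⟩
  rcases eq_or_ne w 0 with rfl | h0
  · simpa using (hsmul y 0 0).ge
  have hn : ‖w‖ ≠ 0 := norm_ne_zero_iff.2 h0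
  have h1 : c ≤ q (y, ‖w‖⁻¹ • w) := by
    refine hcq _ ⟨⟨hy, by simp [norm_smul, hn]⟩, ?_⟩
    change F.coordAt y (F.combination w) = w at hw
    change F.coordAt y (F.combination (‖w‖⁻¹ • w)) = ‖w‖⁻¹ • w
    rw [map_smul, map_smul, hw]
  rw [hsmul] at h1
  calc c * ‖w‖ ^ 2 ≤ (‖w‖⁻¹ ^ 2 * q (y, w)) * ‖w‖ ^ 2 := by gcongr
    _ = q (y, w) := by field_simp

end ProjectiveFrame

end Frame

/-! ### Comparison of the induced metric with derivatives along `V` -/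

section Estimates

theorem ProjectiveFrame.derivAlong_eq_sum {V : Submodule (SmoothFun n M) (VecField n M)} {m : ℕ}
    (F : ProjectiveFrame V m) (Y : V) (f : SmoothFun n M) (y : M) :
    derivAlong Y f y = ∑ a, F.coordAt y Y a * derivAlong (F.gen a) f y := by
  have h : (Y : VecField n M) y = ∑ a, F.coordAt y Y a • (F.gen a : VecField n M) y := by
    change evalOn V y Y = _
    conv_lhs => rw [← F.sum_coord Y, map_sum]
    rfl
  rw [derivAlong_apply, h, map_sum]
  refine Finset.sum_congr rfl fun a _ => ?_
  rw [map_smul]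
  rfl

namespace LieStructure.Metric

variable {L : LieStructure n M} (g : L.Metric)

/-- The norm of a tangent vector of `M₀` for the induced metric. -/
def tangentNorm (x : interiorOpens n M) (ξ : TangentSpace (corners n) x) : ℝ :=
  Real.sqrt (g.induced x ξ ξ)

/-- The differential of the inclusion `M₀ → M`. -/
def inclusionDeriv (x : interiorOpens n M) :
    TangentSpace (corners n) x →L[ℝ] TangentSpace (corners n) (x : M) :=
  mfderiv (corners n) (corners n) (Subtype.val : interiorOpens n M → M) x

/-- The differential at a point of `M₀` of the restriction to `M₀` of a smooth function on `M`. -/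
def differential (f : SmoothFun n M) (x : interiorOpens n M)
    (ξ : TangentSpace (corners n) x) : ℝ :=
  mfderiv (corners n) 𝓘(ℝ, ℝ) f (x : M) (inclusionDeriv x ξ)

/-- A tangent vector of `M₀` is the value of some `Y ∈ V`, and its norm is that of the class of `Y`
in the fiber of `A_V`. -/
theorem exists_section (x : interiorOpens n M) (ξ : TangentSpace (corners n) x) :
    ∃ Y : L.V, (Y : VecField n M) (x : M) = inclusionDeriv x ξ ∧
      g.tangentNorm x ξ = Real.sqrt (g.form x (fiberMk L.V x Y) (fiberMk L.V x Y)) := by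
  obtain ⟨Y, hY⟩ := Submodule.mkQ_surjective _ (L.toFiber x ξ)
  have hY' : fiberMk L.V x Y = L.toFiber x ξ := hY
  refine ⟨Y, ?_, ?_⟩
  · change anchor L.V x (fiberMk L.V x Y) = _
    rw [hY']
    exact (L.anchorEquiv x).apply_symm_apply _
  · rw [hY']
    rfl

theorem form_combination {m : ℕ} (F : ProjectiveFrame L.V m) (y : M) (w : Fin m → ℝ) :
    g.form y (fiberMk L.V y (F.combination w)) (fiberMk L.V y (F.combination w)) =
      ∑ a, ∑ b, w a * (w b * g.form y (fiberMk L.V y (F.gen b)) (fiberMk L.V y (F.gen a))) := by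
  simp [ProjectiveFrame.combination, Finset.mul_sum]

theorem form_combination_smul {m : ℕ} (F : ProjectiveFrame L.V m) (y : M) (w : Fin m → ℝ) (c : ℝ) :
    g.form y (fiberMk L.V y (F.combination (c • w))) (fiberMk L.V y (F.combination (c • w))) =
      c ^ 2 * g.form y (fiberMk L.V y (F.combination w)) (fiberMk L.V y (F.combination w)) := by
  simp only [map_smul, LinearMap.smul_apply, smul_eq_mul]
  ring

theorem continuous_form_combination {m : ℕ} (F : ProjectiveFrame L.V m) :
    Continuous fun q : M × (Fin m → ℝ) =>
      g.form q.1 (fiberMk L.V q.1 (F.combination q.2)) (fiberMk L.V q.1 (F.combination q.2)) := by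
  simp only [form_combination]
  have (a b : Fin m) : Continuous fun y =>
      g.form y (fiberMk L.V y (F.gen a)) (fiberMk L.V y (F.gen b)) :=
    (g.smooth (F.gen a) (F.gen b)).continuous
  refine continuous_finsetSum _ fun a _ => continuous_finsetSum _ fun b _ => ?_
  exact ((continuous_apply a).comp continuous_snd).mul
    (((continuous_apply b).comp continuous_snd).mul ((this b a).comp continuous_fst))

/-- By compactness of `M`, the metric dominates the Euclidean norm of the coordinates. -/
theorem exists_norm_coordAt_le [CompactSpace M] {m : ℕ} (F : ProjectiveFrame L.V m) :
    ∃ C > 0, ∀ (y : M) (Y : L.V), ‖F.coordAt y Y‖ ≤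
      C * Real.sqrt (g.form y (fiberMk L.V y Y) (fiberMk L.V y Y)) := by
  obtain ⟨c, hc, h⟩ := F.exists_pos_mul_sq_le isCompact_univ (g.continuous_form_combination F)
    (fun y w c => g.form_combination_smul F y w c)
    (fun y _ w hw h0 => g.pos y _ (F.fiberMk_combination_ne_zero hw h0))
  refine ⟨(Real.sqrt c)⁻¹, by positivity, fun y Y => ?_⟩
  have h1 := h y trivial _ (F.mem_total y Y)
  simp only [F.fiberMk_combination_coordAt] at h1
  have h2 := Real.sqrt_le_sqrt h1
  rw [Real.sqrt_mul hc.le, Real.sqrt_sq (norm_nonneg _)] at h2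
  rw [inv_mul_eq_div, le_div_iff₀ (by positivity)]
  linarith

/-- A pointwise bound on the derivatives of `f` along the generators of `V` bounds the differential
of `f` with respect to the induced metric. -/
theorem exists_mfderiv_le [CompactSpace M] {m : ℕ} (F : ProjectiveFrame L.V m) :
    ∃ C > 0, ∀ (f : SmoothFun n M) (x : interiorOpens n M) (B : ℝ),
      (∀ a, |derivAlong (F.gen a) f x| ≤ B) → 0 ≤ B → ∀ ξ : TangentSpace (corners n) x,
      |differential f x ξ| ≤ C * B * g.tangentNorm x ξ := by
  obtain ⟨C, hC, h⟩ := g.exists_norm_coordAt_le F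
  -- `m + 1` instead of `m` keeps the constant positive when there are no generators.
  refine ⟨(m + 1) * C, by positivity, fun f x B hB hB0 ξ => ?_⟩
  obtain ⟨Y, hY, hYn⟩ := g.exists_section x ξ
  rw [hYn, differential, ← hY]
  change |derivAlong (Y : VecField n M) f x| ≤ _
  rw [F.derivAlong_eq_sum]
  calc |∑ a, F.coordAt x Y a * derivAlong (F.gen a) f x|
      ≤ ∑ a, |F.coordAt x Y a * derivAlong (F.gen a) f x| := Finset.abs_sum_le_sum_abs _ _
    _ ≤ ∑ _a : Fin m, ‖F.coordAt x Y‖ * B := by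
        refine Finset.sum_le_sum fun a _ => ?_
        rw [abs_mul]
        exact mul_le_mul (norm_le_pi_norm (F.coordAt x Y) a) (hB a) (abs_nonneg _) (norm_nonneg _)
    _ = m * (‖F.coordAt x Y‖ * B) := by simp
    _ ≤ (m + 1) * ((C * Real.sqrt (g.form x (fiberMk L.V x Y) (fiberMk L.V x Y))) * B) := by
        have := h x Y
        gcongr
        linarith
    _ = _ := by ring

end LieStructure.Metric

end Estimates

/-! ### Lengths of paths in `M₀` -/

section Paths

variable (n M) in
/-- The velocity of a path in `M₀`. -/
def velocity (γ : ℝ → interiorOpens n M) (t : ℝ) : TangentSpace (corners n) (γ t) :=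
  mfderiv 𝓘(ℝ, ℝ) (corners n) γ t (1 : ℝ)

theorem hasDerivAt_comp_path (f : SmoothFun n M) {γ : ℝ → interiorOpens n M} {t : ℝ}
    (hγ : MDifferentiableAt 𝓘(ℝ, ℝ) (corners n) γ t) :
    HasDerivAt (fun s => f (γ s))
      (LieStructure.Metric.differential f (γ t) (velocity n M γ t)) t := by
  have h1 : MDifferentiableAt (corners n) (corners n)
      (Subtype.val : interiorOpens n M → M) (γ t) :=
    (contMDiff_subtype_val (n := 1)).mdifferentiableAt one_ne_zero
  have h2 : MDifferentiableAt (corners n) 𝓘(ℝ, ℝ) f (γ t : M) :=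
    f.contMDiff.mdifferentiableAt (by simp)
  have h := (h2.hasMFDerivAt.comp (γ t) h1.hasMFDerivAt).comp t hγ.hasMFDerivAt
  have key (D : ℝ →L[ℝ] ℝ)
      (hD : HasMFDerivAt 𝓘(ℝ, ℝ) 𝓘(ℝ, ℝ) (fun s => (f (γ s) : ℝ)) t D) :
      HasDerivAt (fun s => (f (γ s) : ℝ)) (D 1) t := by
    have h : HasFDerivAt (fun s => (f (γ s) : ℝ)) D t := hD.hasFDerivAt
    exact h.hasDerivAt
  exact key _ h

namespace LieStructure.Metric

variable {L : LieStructure n M} (g : L.Metric)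

/-- The `g`-length of a path in `M₀` on the interval `[a, b]`. -/
def length (γ : ℝ → interiorOpens n M) (a b : ℝ) : ℝ≥0∞ :=
  ∫⁻ t in Set.Icc a b, ENNReal.ofReal (g.tangentNorm (γ t) (velocity n M γ t))

/-- The extended norms on the tangent spaces of `M₀` that enter into the definition of `dist`. -/
abbrev tangentENorm (z : interiorOpens n M) : ENorm (TangentSpace (corners n) z) :=
  ⟨fun v => ENNReal.ofReal (Real.sqrt (g.induced z v v))⟩

theorem exists_path_of_dist_lt {x y : interiorOpens n M} {r : ℝ≥0∞} (h : g.dist x y < r) :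
    ∃ γ : ℝ → interiorOpens n M, γ 0 = x ∧ γ 1 = y ∧
      ContMDiffOn 𝓘(ℝ, ℝ) (corners n) 1 γ (Set.Icc 0 1) ∧ g.length γ 0 1 < r := by
  let := g.tangentENorm
  obtain ⟨γ, h0, h1, h2, h3⟩ := Manifold.exists_lt_of_riemannianEDist_lt (I := corners n) h
  rw [Manifold.pathELength_eq_lintegral_mfderiv_Icc] at h3
  exact ⟨γ, h0, h1, h2, h3⟩

/-- Homogeneity of the norms, which gives the invariance of length under reparametrization and hence
the triangle inequality. -/
theorem enormSMulClass_tangentENorm (z : interiorOpens n M) :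
    letI := g.tangentENorm
    ENormSMulClass ℝ (TangentSpace (corners n) z) := by
  let := g.tangentENorm
  refine ⟨fun c v => ?_⟩
  change ENNReal.ofReal (Real.sqrt (g.induced z (c • v) (c • v))) =
    ‖c‖ₑ * ENNReal.ofReal (Real.sqrt (g.induced z v v))
  rw [map_smul, map_smul, LinearMap.smul_apply, smul_smul, smul_eq_mul, ← sq,
    Real.sqrt_mul (sq_nonneg c), Real.sqrt_sq_eq_abs, ENNReal.ofReal_mul (abs_nonneg c),
    ← Real.norm_eq_abs, ofReal_norm]

theorem dist_le_length {γ : ℝ → interiorOpens n M}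
    (hγ : ContMDiffOn 𝓘(ℝ, ℝ) (corners n) 1 γ (Set.Icc 0 1)) :
    g.dist (γ 0) (γ 1) ≤ g.length γ 0 1 := by
  let := g.tangentENorm
  have := g.enormSMulClass_tangentENorm
  refine (Manifold.riemannianEDist_le_pathELength hγ rfl rfl zero_le_one).trans ?_
  rw [Manifold.pathELength_eq_lintegral_mfderiv_Icc]
  exact le_rfl

theorem dist_triangle (x y z : interiorOpens n M) : g.dist x z ≤ g.dist x y + g.dist y z := by
  let := g.tangentENorm
  have := g.enormSMulClass_tangentENorm
  exact Manifold.riemannianEDist_triangle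

/-- A function on an interval whose derivative is bounded by `C` times the speed of a path varies
by at most `C` times the length of the path. -/
theorem abs_sub_le_of_length_lt {γ : ℝ → interiorOpens n M} {φ : ℝ → ℝ} {a b C ε : ℝ} (hab : a ≤ b)
    (hφ : ContDiffOn ℝ 1 φ (Set.Icc a b)) (hC : 0 ≤ C) (hε : 0 ≤ ε)
    (hd : ∀ t ∈ Set.Ioo a b, |deriv φ t| ≤ C * g.tangentNorm (γ t) (velocity n M γ t))
    (hl : g.length γ a b ≤ ENNReal.ofReal ε) : |φ b - φ a| ≤ C * ε := by
  have h : ‖φ b - φ a‖ₑ ≤ ENNReal.ofReal C * g.length γ a b := by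
    refine (enorm_sub_le_lintegral_deriv_of_contDiffOn_Icc hφ hab).trans ?_
    rw [length, ← MeasureTheory.lintegral_const_mul' _ _ ENNReal.ofReal_ne_top,
      ← MeasureTheory.restrict_Ioo_eq_restrict_Icc]
    refine MeasureTheory.setLIntegral_mono' measurableSet_Ioo fun t ht => ?_
    rw [← ENNReal.ofReal_mul hC, ← ofReal_norm]
    exact ENNReal.ofReal_le_ofReal (hd t ht)
  have h2 := h.trans (mul_le_mul_right hl _)
  rw [← ENNReal.ofReal_mul hC, ← ofReal_norm] at h2
  exact (ENNReal.ofReal_le_ofReal_iff (by positivity)).1 h2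

theorem length_mono_right {γ : ℝ → interiorOpens n M} {a b c : ℝ} (h : b ≤ c) :
    g.length γ a b ≤ g.length γ a c :=
  MeasureTheory.lintegral_mono_set (Set.Icc_subset_Icc_right h)

end LieStructure.Metric

end Paths

/-! ### Defining functions of the boundary -/

section Coordinates

/-- The interior does not depend on the chart: all chart coordinates are positive on `M₀`. -/
theorem extChartAt_pos {p y : M} (hy : y ∈ (extChartAt (corners n) p).source)
    (h0 : y ∈ interiorOpens n M) (i : Fin n) : 0 < extChartAt (corners n) p y i := by
  have h1 := ((corners n).isInteriorPoint_iff_of_mem_atlas (n := ∞) (by simp)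
    (chart_mem_atlas _ p) (by simpa using hy)).1 h0
  have h2 := (chartAt _ p).interior_extend_target_subset_interior_range h1
  rw [range_corners, interior_euclideanQuadrant] at h2
  exact h2 i

theorem exists_extChartAt_eq_zero {p : M} (hp : p ∉ interiorOpens n M) :
    ∃ i, extChartAt (corners n) p p i = 0 := by
  by_contra! h
  refine hp ?_
  change extChartAt (corners n) p p ∈ interior (Set.range (corners n))
  rw [range_corners, interior_euclideanQuadrant]
  exact fun i => (extChartAt_nonneg (mem_extChartAt_source p) i).lt_of_ne' (h i)

/-- The coordinates of a chart at `p` agree near `p` with smooth functions on `M`. -/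
theorem exists_coordinate_functions [T2Space M] (p : M) :
    ∃ f : Fin n → SmoothFun n M, ∀ᶠ y in 𝓝 p, ∀ i, f i y = extChartAt (corners n) p y i := by
  obtain ⟨χ⟩ : Nonempty (SmoothBumpFunction (corners n) p) := inferInstance
  have h (i : Fin n) : ContMDiffOn (corners n) 𝓘(ℝ, ℝ) ∞
      (fun y => extChartAt (corners n) p y i) (chartAt (EuclideanQuadrant n) p).source :=
    ((EuclideanSpace.proj i : EuclideanSpace ℝ (Fin n) →L[ℝ] ℝ).contMDiff).comp_contMDiffOn
      contMDiffOn_extChartAt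
  refine ⟨fun i => ⟨fun y => χ y • extChartAt (corners n) p y i, χ.contMDiff_smul (h i)⟩, ?_⟩
  filter_upwards [χ.eventuallyEq_one] with y hy i
  change χ y • extChartAt (corners n) p y i = _
  rw [hy]
  exact one_smul ℝ _

/-- Near a boundary point `p` there is a function `f` vanishing at `p` and positive on `M₀`, whose
logarithmic derivatives along finitely many vector fields tangent to the faces are bounded. -/
theorem exists_defining_function [T2Space M] {p : M} (hp : p ∉ interiorOpens n M) {m : ℕ}
    (X : Fin m → VecField n M) (hX : ∀ a, TangentToFaces (X a)) :
    ∃ f : SmoothFun n M, f p = 0 ∧ ∃ C ≥ 0, ∀ᶠ y in 𝓝 p,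
      (y ∈ interiorOpens n M → 0 < f y) ∧ ∀ a, |derivAlong (X a) f y| ≤ C * f y := by
  obtain ⟨i, hi⟩ := exists_extChartAt_eq_zero (n := n) hp
  obtain ⟨f, hf⟩ := exists_coordinate_functions (n := n) p
  have hfi : ∀ᶠ y in 𝓝 p, f i y = extChartAt (corners n) p y i := hf.mono fun y hy => hy i
  have hd (a : Fin m) : ∃ C ≥ 0, ∀ᶠ y in 𝓝 p,
      |derivAlong (X a) (f i) y| ≤ C * extChartAt (corners n) p y i := by
    refine exists_abs_le_mul_coordinate hi _ ?_
    filter_upwards [hfi.eventually_nhds, extChartAt_source_mem_nhds (I := corners n) p]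
      with y hy hys hy0
    rw [derivAlong_apply, Filter.EventuallyEq.mfderiv_eq hy]
    exact hX a p y hys i hy0
  choose C hC hCd using hd
  refine ⟨f i, ?_, ∑ a, C a, Finset.sum_nonneg fun a _ => hC a, ?_⟩
  · rw [hfi.self_of_nhds, hi]
  · filter_upwards [hfi, extChartAt_source_mem_nhds (I := corners n) p,
      Filter.eventually_all.2 hCd] with y hy hys hyd
    refine ⟨fun hy0 => hy ▸ extChartAt_pos (n := n) hys hy0 i, fun a => (hyd a).trans ?_⟩
    rw [hy]
    exact mul_le_mul_of_nonneg_right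
      (Finset.single_le_sum (fun b _ => hC b) (Finset.mem_univ a)) (extChartAt_nonneg (n := n) hys i)

end Coordinates

/-! ### Cauchy sequences stay away from the boundary -/

namespace LieStructure.Metric

variable {L : LieStructure n M} (g : L.Metric)

section Boundary

theorem exists_bound_derivAlong [CompactSpace M] {m : ℕ} (X : Fin m → VecField n M)
    (f : SmoothFun n M) : ∃ B ≥ 0, ∀ a y, |derivAlong (X a) f y| ≤ B := by
  have h (a : Fin m) : ∃ B, ∀ y, |derivAlong (X a) f y| ≤ B := by
    obtain ⟨B, hB⟩ := isCompact_univ.exists_bound_of_continuousOn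
      (derivAlong (X a) f).contMDiff.continuous.continuousOn
    exact ⟨B, fun y => hB y trivial⟩
  choose B hB using h
  refine ⟨∑ a, |B a|, Finset.sum_nonneg fun a _ => abs_nonneg _, fun a y => ?_⟩
  exact ((hB a y).trans (le_abs_self _)).trans
    (Finset.single_le_sum (fun b _ => abs_nonneg (B b)) (Finset.mem_univ a))

theorem contDiffOn_comp_path (f : SmoothFun n M) {γ : ℝ → interiorOpens n M} {s : Set ℝ}
    (hγ : ContMDiffOn 𝓘(ℝ, ℝ) (corners n) 1 γ s) : ContDiffOn ℝ 1 (fun t => f (γ t)) s := by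
  have h : ContMDiff (corners n) 𝓘(ℝ, ℝ) 1 f := f.contMDiff.of_le (by simp)
  exact contMDiffOn_iff_contDiffOn.1
    (h.comp_contMDiffOn (contMDiff_subtype_val.comp_contMDiffOn hγ))

theorem mdifferentiableAt_path {γ : ℝ → interiorOpens n M} {a b t : ℝ}
    (hγ : ContMDiffOn 𝓘(ℝ, ℝ) (corners n) 1 γ (Set.Icc a b)) (ht : t ∈ Set.Ioo a b) :
    MDifferentiableAt 𝓘(ℝ, ℝ) (corners n) γ t :=
  ((hγ t (Set.Ioo_subset_Icc_self ht)).contMDiffAt (Icc_mem_nhds ht.1 ht.2)).mdifferentiableAt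
    one_ne_zero

/-- A smooth function on `M` that equals `1` near `p` cannot become nonpositive along a short path
starting where it is `1`, and the logarithm of a defining function changes little along a short
path that stays near `p`. Hence a Cauchy sequence does not accumulate at the boundary. -/
theorem mem_interior_of_mapClusterPt [T2Space M] [CompactSpace M] {u : ℕ → interiorOpens n M}
    (hu : ∀ ε : ℝ≥0∞, 0 < ε → ∃ N : ℕ, ∀ j ≥ N, ∀ k ≥ N, g.dist (u j) (u k) < ε) {p : M}
    (hp : MapClusterPt p Filter.atTop fun k => (u k : M)) : p ∈ interiorOpens n M := by
  by_contra hpi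
  have := L.structural.finite
  have := L.structural.projective
  obtain ⟨m, ⟨F⟩⟩ := exists_projectiveFrame (V := L.V)
  obtain ⟨A, hA, hAd⟩ := g.exists_mfderiv_le F
  obtain ⟨f, hfp, C, hC, hfC⟩ := exists_defining_function hpi (fun a => (F.gen a : VecField n M))
    fun a => L.structural.tangent _ (F.gen a).2
  obtain ⟨χ, -, hχ⟩ := (SmoothBumpFunction.nhds_basis_tsupport (I := corners n) p).mem_iff.1 hfC
  obtain ⟨B, hB, hBd⟩ := exists_bound_derivAlong (fun a => (F.gen a : VecField n M))
    (⟨χ, χ.contMDiff⟩ : SmoothFun n M)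
  set χ' : SmoothFun n M := ⟨χ, χ.contMDiff⟩
  -- `χ'` has Lipschitz constant `A * B`, so it varies by less than `1` on paths of length `ε`.
  set ε : ℝ := 1 / (A * B + 1) with hε
  have hε0 : 0 < ε := by positivity
  have hε1 : A * B * ε < 1 := by
    rw [hε, mul_one_div, div_lt_one (by positivity)]
    linarith
  obtain ⟨N, hN⟩ := hu (ENNReal.ofReal ε) (by simpa using hε0)
  have hfreq {P : M → Prop} (hP : ∀ᶠ y in 𝓝 p, P y) : ∃ k ≥ N, P (u k) := by
    obtain ⟨k, hk, hkN⟩ :=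
      ((mapClusterPt_iff_frequently.1 hp _ hP).and_eventually (Filter.eventually_ge_atTop N)).exists
    exact ⟨k, hkN, hk⟩
  obtain ⟨j, hjN, hj⟩ := hfreq χ.eventuallyEq_one
  have hpos {y : interiorOpens n M} (hy : 0 < χ' y) : 0 < f y ∧
      ∀ a, |derivAlong (F.gen a : VecField n M) f y| ≤ C * f y := by
    have h := hχ (subset_tsupport _ (show (y : M) ∈ Function.support χ from hy.ne'))
    exact ⟨h.1 y.2, h.2⟩
  have hj' : χ' (u j) = 1 := hj
  have hfj : 0 < f (u j) := (hpos (hj' ▸ one_pos)).1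
  -- With `u j` fixed, `u k` is taken so close to `p` that `log f` drops by more than `A * C * ε`,
  -- the most it can change along a path of length `ε` inside the support of `χ'`.
  obtain ⟨k, hkN, hk⟩ := hfreq (P := fun y => f y < f (u j) * Real.exp (-(A * C * ε)))
    (f.contMDiff.continuous.continuousAt.eventually_lt continuousAt_const (by
      rw [hfp]
      positivity))
  obtain ⟨γ, hγ0, hγ1, hγ, hl⟩ := g.exists_path_of_dist_lt (hN j hjN k hkN)
  have hχpos (t : ℝ) (ht : t ∈ Set.Icc (0 : ℝ) 1) : 0 < χ' (γ t) := by
    have h1 := g.abs_sub_le_of_length_lt (φ := fun s => χ' (γ s)) ht.1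
      (contDiffOn_comp_path χ' (hγ.mono (Set.Icc_subset_Icc_right ht.2)))
      (mul_nonneg hA.le hB) hε0.le (fun s hs => ?_) ((g.length_mono_right ht.2).trans hl.le)
    · rw [hγ0, hj'] at h1
      linarith [(abs_le.1 h1).1]
    · rw [(hasDerivAt_comp_path χ' (mdifferentiableAt_path hγ ⟨hs.1, hs.2.trans_le ht.2⟩)).deriv]
      exact hAd χ' (γ s) B (fun a => hBd a _) hB _
  have hf (t : ℝ) (ht : t ∈ Set.Icc (0 : ℝ) 1) := hpos (hχpos t ht)
  have h2 := g.abs_sub_le_of_length_lt (φ := fun s => Real.log (f (γ s))) zero_le_one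
    ((contDiffOn_comp_path f hγ).log fun t ht => (hf t ht).1.ne')
    (mul_nonneg hA.le hC) hε0.le (fun t ht => ?_) hl.le
  · rw [hγ0, hγ1] at h2
    have hk0 : 0 < f (u k) := hγ1 ▸ (hf 1 (by simp)).1
    have h3 := Real.log_lt_log hk0 hk
    rw [Real.log_mul hfj.ne' (Real.exp_ne_zero _), Real.log_exp] at h3
    linarith [(abs_le.1 h2).1]
  · have hft := hf t (Set.Ioo_subset_Icc_self ht)
    rw [((hasDerivAt_comp_path f (mdifferentiableAt_path hγ ht)).log hft.1.ne').deriv, abs_div,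
      abs_of_pos hft.1, div_le_iff₀ hft.1]
    refine (hAd f (γ t) (C * f (γ t)) hft.2 (mul_nonneg hC hft.1.le) _).trans_eq ?_
    ring

end Boundary

end LieStructure.Metric

/-! ### The Riemannian distance near an interior point -/

namespace LieStructure.Metric

variable {L : LieStructure n M} (g : L.Metric)

section Interior

theorem derivAlong_eq_mfderiv_extChartAt {p y : M} {i : Fin n} {f : SmoothFun n M}
    (hf : ∀ᶠ z in 𝓝 y, f z = extChartAt (corners n) p z i)
    (hy : y ∈ (extChartAt (corners n) p).source) (X : VecField n M) :
    derivAlong X f y =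
      (EuclideanSpace.proj i : EuclideanSpace ℝ (Fin n) →L[ℝ] ℝ)
        (mfderiv (corners n) 𝓘(ℝ, EuclideanSpace ℝ (Fin n)) (extChartAt (corners n) p) y (X y)) := by
  rw [derivAlong_apply, Filter.EventuallyEq.mfderiv_eq hf]
  have h := (EuclideanSpace.proj i : EuclideanSpace ℝ (Fin n) →L[ℝ] ℝ).hasMFDerivAt.comp y
    (mdifferentiableAt_extChartAt (I := corners n) (by simpa using hy)).hasMFDerivAt
  exact congrArg (fun D => D (X y)) h.mfderiv

theorem exists_form_combination_le [CompactSpace M] {m : ℕ} (F : ProjectiveFrame L.V m) :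
    ∃ B > 0, ∀ (y : M) (w : Fin m → ℝ),
      g.form y (fiberMk L.V y (F.combination w)) (fiberMk L.V y (F.combination w)) ≤
        B * ‖w‖ ^ 2 := by
  have h (a b : Fin m) : ∃ B, ∀ y,
      |g.form y (fiberMk L.V y (F.gen a)) (fiberMk L.V y (F.gen b))| ≤ B := by
    obtain ⟨B, hB⟩ := isCompact_univ.exists_bound_of_continuousOn
      (g.smooth (F.gen a) (F.gen b)).continuous.continuousOn
    exact ⟨B, fun y => hB y trivial⟩
  choose B hB using h
  refine ⟨∑ a, ∑ b, |B b a| + 1, by positivity, fun y w => ?_⟩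
  rw [g.form_combination, add_mul, Finset.sum_mul]
  refine le_add_of_le_of_nonneg (Finset.sum_le_sum fun a _ => ?_) (by positivity)
  rw [Finset.sum_mul]
  refine Finset.sum_le_sum fun b _ => (le_abs_self _).trans ?_
  rw [abs_mul, abs_mul, ← mul_assoc, mul_comm, sq]
  have ha : |w a| ≤ ‖w‖ := norm_le_pi_norm w a
  have hb : |w b| ≤ ‖w‖ := norm_le_pi_norm w b
  have := (hB b a y).trans (le_abs_self _)
  gcongr

theorem continuous_derivAlong_combination {m : ℕ} {V : Submodule (SmoothFun n M) (VecField n M)}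
    (F : ProjectiveFrame V m) (f : SmoothFun n M) :
    Continuous fun q : M × (Fin m → ℝ) => derivAlong (F.combination q.2 : VecField n M) f q.1 := by
  have h (q : M × (Fin m → ℝ)) : derivAlong (F.combination q.2 : VecField n M) f q.1 =
      ∑ a, q.2 a * derivAlong (F.gen a : VecField n M) f q.1 := by
    have h : (F.combination q.2 : VecField n M) q.1 =
        ∑ a, q.2 a • (F.gen a : VecField n M) q.1 := by
      change evalOn V q.1 (∑ a, q.2 a • F.gen a) = _
      rw [map_sum]
      rfl
    rw [derivAlong_apply, h, map_sum]
    refine Finset.sum_congr rfl fun a _ => ?_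
    rw [map_smul]
    rfl
  simp only [h]
  refine continuous_finsetSum _ fun a _ => ((continuous_apply a).comp continuous_snd).mul ?_
  exact (derivAlong (F.gen a : VecField n M) f).contMDiff.continuous.comp continuous_fst

/-- Near an interior point the induced metric is bounded by the Euclidean metric of a chart. -/
theorem exists_tangentNorm_le [T2Space M] [CompactSpace M] (p : interiorOpens n M) :
    ∃ C > 0, ∃ f : Fin n → SmoothFun n M, ∀ᶠ y in 𝓝 (p : M),
      (∀ i, f i y = extChartAt (corners n) (p : M) y i) ∧
      ∃ hy : y ∈ interiorOpens n M, ∀ ξ, g.tangentNorm ⟨y, hy⟩ ξ ^ 2 ≤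
        C * ∑ i, differential (f i) ⟨y, hy⟩ ξ ^ 2 := by
  have := L.structural.finite
  have := L.structural.projective
  obtain ⟨m, ⟨F⟩⟩ := exists_projectiveFrame (V := L.V)
  obtain ⟨f, hf⟩ := exists_coordinate_functions (n := n) (p : M)
  obtain ⟨K, hKp, hK, hKc⟩ := local_compact_nhds
    ((hf.eventually_nhds.and (extChartAt_source_mem_nhds (I := corners n) (p : M))).and
      ((interiorOpens n M).isOpen.mem_nhds p.2))
  have hsmul (y : M) (w : Fin m → ℝ) (c : ℝ) (i : Fin n) :
      derivAlong (F.combination (c • w) : VecField n M) (f i) y =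
        c * derivAlong (F.combination w : VecField n M) (f i) y := by
    rw [map_smul]
    exact map_smul (mfderiv (corners n) 𝓘(ℝ, ℝ) (f i) y) c _
  obtain ⟨c, hc, hcq⟩ := F.exists_pos_mul_sq_le hKc
    (q := fun q => ∑ i, derivAlong (F.combination q.2 : VecField n M) (f i) q.1 ^ 2)
    (continuous_finsetSum _ fun i _ => (continuous_derivAlong_combination F (f i)).pow 2)
    (fun y w c => by simp only [hsmul, mul_pow, Finset.mul_sum])
    (fun y hy w hw h0 => by
      obtain ⟨⟨hyf, hys⟩, hyi⟩ := hK hy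
      refine (Finset.sum_nonneg fun i _ => sq_nonneg _).lt_of_ne' fun hsum => ?_
      rw [Finset.sum_eq_zero_iff_of_nonneg fun i _ => sq_nonneg _] at hsum
      refine F.fiberMk_combination_ne_zero hw h0 ((L.anchor_bijective y hyi).1 ?_)
      rw [map_zero]
      change (F.combination w : VecField n M) y = 0
      apply (isInvertible_mfderiv_extChartAt (I := corners n) hys).injective
      rw [map_zero]
      apply (WithLp.ofLp_injective 2 : Function.Injective
        (WithLp.ofLp : EuclideanSpace ℝ (Fin n) → Fin n → ℝ))
      funext i
      have := hsum i (Finset.mem_univ i)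
      rw [derivAlong_eq_mfderiv_extChartAt (hyf.mono fun z hz => hz i) hys] at this
      exact pow_eq_zero_iff two_ne_zero |>.1 this)
  obtain ⟨B, hB, hBd⟩ := g.exists_form_combination_le F
  refine ⟨B / c, by positivity, f, ?_⟩
  filter_upwards [hf, hKp] with y hy hyK
  refine ⟨hy, (hK hyK).2, fun ξ => ?_⟩
  obtain ⟨Y, hY, hYn⟩ := g.exists_section ⟨y, (hK hyK).2⟩ ξ
  have hval : (F.combination (F.coordAt y Y) : VecField n M) y = (Y : VecField n M) y :=
    congrArg (anchor L.V y) (F.fiberMk_combination_coordAt y Y)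
  have h1 := hcq y hyK _ (F.mem_total y Y)
  have h2 := hBd y (F.coordAt y Y)
  have h3 : ∑ i, derivAlong (F.combination (F.coordAt y Y) : VecField n M) (f i) y ^ 2 =
      ∑ i, differential (f i) ⟨y, (hK hyK).2⟩ ξ ^ 2 := by
    refine Finset.sum_congr rfl fun i _ => ?_
    rw [derivAlong_apply, hval, differential, ← hY]
  rw [F.fiberMk_combination_coordAt] at h2
  have h0 : 0 ≤ g.form y (fiberMk L.V y Y) (fiberMk L.V y Y) := by
    rcases eq_or_ne (fiberMk L.V y Y) 0 with h | h
    · simp [h]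
    · exact (g.pos y _ h).le
  rw [hYn, Real.sq_sqrt h0, ← h3]
  calc _ ≤ B * ‖F.coordAt y Y‖ ^ 2 := h2
    _ = B / c * (c * ‖F.coordAt y Y‖ ^ 2) := by field_simp
    _ ≤ _ := by gcongr

/-- The Riemannian distance to an interior point `p` is continuous at `p` for the topology of `M`:
the segments of a chart at `p` are short paths. -/
theorem eventually_dist_lt [T2Space M] [CompactSpace M] (p : interiorOpens n M) {ε : ℝ≥0∞}
    (hε : 0 < ε) : ∀ᶠ y in 𝓝 (p : M), ∀ hy : y ∈ interiorOpens n M, g.dist ⟨y, hy⟩ p < ε := by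
  obtain ⟨C, hC, f, hf⟩ := g.exists_tangentNorm_le p
  obtain ⟨r, hr, hrf⟩ := exists_ball_subset_of_eventually (n := n) hf
  set e := extChartAt (corners n) (p : M)
  have hcont : ContinuousAt (fun y : M => ENNReal.ofReal (Real.sqrt C * ‖e p - e y‖)) p := by
    refine ENNReal.continuous_ofReal.continuousAt.comp ?_
    exact continuousAt_const.mul
      (continuousAt_const.sub (continuousAt_extChartAt (I := corners n) (p : M))).norm
  filter_upwards [extChartAt_source_mem_nhds (I := corners n) (p : M),
    (continuousAt_extChartAt (I := corners n) (p : M)).preimage_mem_nhds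
      (Metric.ball_mem_nhds _ hr),
    hcont.eventually_lt continuousAt_const (by simpa using hε)] with y hys hyr hyε hy
  let c : ℝ → EuclideanSpace ℝ (Fin n) := fun t => e y + t • (e p - e y)
  have hc (t : ℝ) (ht : t ∈ Set.Icc (0 : ℝ) 1) : c t ∈ e.target ∧
      (∀ i, f i (e.symm (c t)) = c t i) ∧
      ∃ hy : e.symm (c t) ∈ interiorOpens n M, ∀ ξ, g.tangentNorm ⟨e.symm (c t), hy⟩ ξ ^ 2 ≤
        C * ∑ i, differential (f i) ⟨e.symm (c t), hy⟩ ξ ^ 2 := by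
    have hb : c t ∈ Metric.ball (e p) r :=
      (convex_ball (e p) r).add_smul_sub_mem hyr (Metric.mem_ball_self hr) ht
    have h0 : c t ∈ Set.range (corners n) :=
      (corners n).convex_range.add_smul_sub_mem
        (extChartAt_target_subset_range _ (e.map_source hys))
        (extChartAt_target_subset_range _ (e.map_source (mem_extChartAt_source _))) ht
    rw [range_corners] at h0
    obtain ⟨h1, h2, h3⟩ := hrf (c t) hb h0
    refine ⟨h1, fun i => ?_, h3⟩
    rw [h2 i, e.right_inv h1]
  classical
  -- Outside `[0, 1]` the path is irrelevant, and the value `p` there is arbitrary.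
  let γ : ℝ → interiorOpens n M := fun t =>
    if h : e.symm (c t) ∈ interiorOpens n M then ⟨e.symm (c t), h⟩ else p
  have hγc {t : ℝ} (ht : t ∈ Set.Icc (0 : ℝ) 1) : γ t = ⟨e.symm (c t), (hc t ht).2.2.1⟩ :=
    dif_pos (hc t ht).2.2.1
  have hγ : ContMDiffOn 𝓘(ℝ, ℝ) (corners n) 1 γ (Set.Icc 0 1) := by
    intro t ht
    refine ContMDiffWithinAt.of_le (n := ∞) ?_ (by simp)
    rw [← ContMDiffWithinAt.subtypeVal_comp_iff]
    have hcs : ContMDiff 𝓘(ℝ, ℝ) 𝓘(ℝ, EuclideanSpace ℝ (Fin n)) ∞ c :=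
      ContDiff.contMDiff (by fun_prop)
    have h := (contMDiffOn_extChartAt_symm (I := corners n) (n := ∞) (p : M)).comp
      hcs.contMDiffOn (s := Set.Icc (0 : ℝ) 1) fun t ht => (hc t ht).1
    refine (h t ht).congr_of_mem (fun s hs => ?_) ht
    exact congrArg Subtype.val (hγc hs)
  have h0 : γ 0 = ⟨y, hy⟩ := by
    rw [hγc (by simp)]
    simp [c, e.left_inv hys]
  have h1 : γ 1 = p := by
    rw [hγc (by simp)]
    simp [c, e]
  rw [← h0, ← h1]
  refine (g.dist_le_length hγ).trans_lt (lt_of_le_of_lt ?_ hyε)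
  have hspeed (t : ℝ) (ht : t ∈ Set.Ioo (0 : ℝ) 1) :
      g.tangentNorm (γ t) (velocity n M γ t) ≤ Real.sqrt C * ‖e p - e y‖ := by
    have hd (i : Fin n) : differential (f i) (γ t) (velocity n M γ t) = (e p - e y) i := by
      have hd1 := hasDerivAt_comp_path (f i) (mdifferentiableAt_path hγ ht)
      have hd2 : HasDerivAt (fun s => e y i + s * (e p - e y) i) ((e p - e y) i) t := by
        simpa using ((hasDerivAt_id t).mul_const ((e p - e y) i)).const_add (e y i)
      refine hd1.unique (hd2.congr_of_eventuallyEq ?_)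
      filter_upwards [Icc_mem_nhds ht.1 ht.2] with s hs
      rw [hγc hs]
      exact (hc s hs).2.1 i
    have hle : g.tangentNorm (γ t) (velocity n M γ t) ^ 2 ≤
        C * ∑ i, differential (f i) (γ t) (velocity n M γ t) ^ 2 := by
      have hall : ∀ ξ, g.tangentNorm (γ t) ξ ^ 2 ≤ C * ∑ i, differential (f i) (γ t) ξ ^ 2 := by
        rw [hγc (Set.Ioo_subset_Icc_self ht)]
        exact (hc t (Set.Ioo_subset_Icc_self ht)).2.2.2
      exact hall _
    simp only [hd] at hle
    rw [EuclideanSpace.norm_eq, ← Real.sqrt_mul hC.le]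
    refine Real.le_sqrt_of_sq_le (hle.trans_eq ?_)
    simp
  rw [length, ← MeasureTheory.restrict_Ioo_eq_restrict_Icc]
  calc _ ≤ ∫⁻ _t in Set.Ioo (0 : ℝ) 1, ENNReal.ofReal (Real.sqrt C * ‖e p - e y‖) :=
        MeasureTheory.setLIntegral_mono' measurableSet_Ioo fun t ht =>
          ENNReal.ofReal_le_ofReal (hspeed t ht)
    _ = _ := by simp

end Interior

end LieStructure.Metric

end LieInfinity

end

/-- A Riemannian manifold `M₀` with a Lie structure at infinity `(M, 𝒱, g)` is complete in the
induced metric. -/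
theorem corollary3p9 {n : ℕ} {M : Type*} [TopologicalSpace M] [T2Space M] [CompactSpace M]
    [ChartedSpace (EuclideanQuadrant n) M] [IsManifold (LieInfinity.corners n) ∞ M]
    (𝒱 : LieInfinity.LieStructure n M) (g : 𝒱.Metric) : g.IsComplete := by
  intro u hu
  obtain ⟨p, hp⟩ := exists_clusterPt_of_compactSpace (Filter.map (fun k => (u k : M)) Filter.atTop)
  have hp' : MapClusterPt p Filter.atTop fun k => (u k : M) := hp
  let x : LieInfinity.interiorOpens n M := ⟨p, g.mem_interior_of_mapClusterPt hu hp'⟩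
  refine ⟨x, ENNReal.tendsto_nhds_zero.2 fun ε hε => ?_⟩
  have hε2 : 0 < ε / 2 := ENNReal.half_pos hε.ne'
  obtain ⟨N, hN⟩ := hu (ε / 2) hε2
  obtain ⟨j, hj, hjN⟩ := ((mapClusterPt_iff_frequently.1 hp' _
    (g.eventually_dist_lt x hε2)).and_eventually (Filter.eventually_ge_atTop N)).exists
  filter_upwards [Filter.eventually_ge_atTop N] with k hk
  calc g.dist (u k) x ≤ g.dist (u k) (u j) + g.dist (u j) x := g.dist_triangle _ _ _
    _ ≤ ε / 2 + ε / 2 := add_le_add (hN k hk j hjN).le (hj (u j).2).le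
    _ = ε := ENNReal.add_halves ε
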